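/- For $s\in\mathbb{C}$ and $q\in\mathbb C$ with $|q|<1$ let $$\mathcal{L}_q(s)=\sum_{n=1}^\infty \frac{n^s q^n}{1-q^n}$$ be the Lambert series, let $B_n$ denote the Bernoulli numbers and $\zeta$ the Riemann zeta function, and put $\theta=\cot^{-1}\sqrt7\in(0,\pi/2)$. **Theorem.** For every integer $k\ge 1$ the three Lambert series below converge, and $$\begin{aligned} \zeta(4k+1)={}&(2\pi)^{4k+1}\sum_{j=0}^{k}\frac{(-1)^j\,c_{jk}\,B_{2j}\,B_{4k+2-2j}}{(2j)!\,(4k+2-2j)!}+a_k\,\mathcal{L}_{e^{-\sqrt7\pi}}(-4k-1)\\ &+b_k\,\mathcal{L}_{e^{-2\sqrt7\pi}}(-4k-1)+2^{-4k}a_k\,\mathcal{L}_{e^{-4\sqrt7\pi}}(-4k-1), \end{aligned}$$ where $$\begin{aligned} a_k&=\frac{2+2^{-4k}-2^{-2k+1}\cos(4k\theta)}{1-2^{-2k}\cos(4k\theta)},\\ b_k&=-\frac{4+3\cdot 2^{-4k}+2^{-8k}-2^{-2k+2}\cos(4k\theta)-2^{-6k+1}\cos(4k\theta)}{1-2^{-2k}\cos(4k\theta)},\\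 c_{jk}&=\frac{2^{2k+\frac12-j}\cos[(2j-1)\theta]-2^{j-\frac12}\cos[(4k+1-2j)\theta]}{2^{2k}-\cos(4k\theta)}. \end{aligned}$$ -/

import Mathlib

/-- The term of index `n + 1` of the Lambert series `∑_{n ≥ 1} n ^ s * q ^ n / (1 - q ^ n)`. -/
noncomputable def lambertTerm (q s : ℂ) (n : ℕ) : ℂ :=
  ((n + 1 : ℕ) : ℂ) ^ s * q ^ (n + 1) / (1 - q ^ (n + 1))

/-- The Lambert series `L_q(s) = ∑_{n ≥ 1} n ^ s * q ^ n / (1 - q ^ n)`, for `|q| < 1`. -/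
noncomputable def lambertL (q s : ℂ) : ℂ := ∑' n : ℕ, lambertTerm q s n

/-- The inverse cotangent, with values in `(0, π)`. -/
noncomputable def arccot (x : ℝ) : ℝ := Real.pi / 2 - Real.arctan x

/-- `θ = arccot √7`. -/
noncomputable def thetaSeven : ℝ := arccot (Real.sqrt 7)

/-- The coefficient `a_k`. -/
noncomputable def coeffA (k : ℕ) : ℝ :=
  (2 + (2 : ℝ) ^ (-4 * k : ℤ) - (2 : ℝ) ^ (-2 * k + 1 : ℤ) * Real.cos (4 * k * thetaSeven)) /
    (1 - (2 : ℝ) ^ (-2 * k : ℤ) * Real.cos (4 * k * thetaSeven))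

/-- The coefficient `b_k`. -/
noncomputable def coeffB (k : ℕ) : ℝ :=
  -((4 + 3 * (2 : ℝ) ^ (-4 * k : ℤ) + (2 : ℝ) ^ (-8 * k : ℤ)
      - (2 : ℝ) ^ (-2 * k + 2 : ℤ) * Real.cos (4 * k * thetaSeven)
      - (2 : ℝ) ^ (-6 * k + 1 : ℤ) * Real.cos (4 * k * thetaSeven)) /
    (1 - (2 : ℝ) ^ (-2 * k : ℤ) * Real.cos (4 * k * thetaSeven)))

/-- The coefficient `c_{jk}`; the powers of `2` have half-integer exponents. -/
noncomputable def coeffC (j k : ℕ) : ℝ :=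
  ((2 : ℝ) ^ (2 * k + 1 / 2 - j : ℝ) * Real.cos ((2 * j - 1) * thetaSeven)
      - (2 : ℝ) ^ (j - 1 / 2 : ℝ) * Real.cos ((4 * k + 1 - 2 * j) * thetaSeven)) /
    ((2 : ℝ) ^ (2 * k) - Real.cos (4 * k * thetaSeven))

/-! Write N = 4k+1 and F(q) = ζ(N)/2 + L_q(-N), which is `completedLambert`. Ramanujan's formula
(`completedLambert_sub_completedLambert_neg_inv`) says that, with q = e^{2πiz}, F transforms under z
↦ -1/z like an Eisenstein series of weight 1-N, up to an explicit Bernoulli sum. It follows by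
expanding ∑ π cot(πmz)/m^N both in exponentials and in partial fractions.

Apply it at z = (±1+√-7)/4 and add. Since |z|² = 1/2, inversion sends these points to (∓1+√-7)/2,
which differ by 1 and so share the nome -q, where q = e^{-√7π}; the points themselves have nomes ±r
with r² = -q. The Hecke relation at 2 (`completedLambert_add_neg`), used at r, turns F(r)+F(-r) into
F(-q) and F(q²); used at q, it replaces F(-q) by F(q), F(q²), F(q⁴). In the resulting linear
relation ζ(N) has coefficient 1 - 2^{-2k}cos(4kθ), which is nonzero; dividing by it gives a_k, b_k
and c_{jk}. The cosines come from z = (i/√2)e^{∓iθ}. -/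

/-! ### Lambert series at negative integers: convergence -/

lemma lambertTerm_neg_natCast (q : ℂ) (N m : ℕ) :
    lambertTerm q (-(N : ℂ)) m = q ^ (m + 1) / (1 - q ^ (m + 1)) / ((m : ℂ) + 1) ^ N := by
  unfold lambertTerm
  rw [Complex.cpow_neg, Complex.cpow_natCast]
  push_cast
  ring

lemma one_sub_pow_ne_zero_of_norm_lt_one {q : ℂ} (hq : ‖q‖ < 1) (m : ℕ) :
    1 - q ^ (m + 1) ≠ 0 := by
  intro h
  have h1 : ‖q ^ (m + 1)‖ < 1 := by
    rw [norm_pow]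
    exact pow_lt_one₀ (norm_nonneg q) hq (Nat.succ_ne_zero m)
  rw [← sub_eq_zero.mp h, norm_one] at h1
  exact lt_irrefl _ h1

lemma summable_lambertTerm_neg_natCast {q : ℂ} (hq : ‖q‖ < 1) (N : ℕ) :
    Summable (lambertTerm q (-(N : ℂ))) := by
  have hg : Summable fun m : ℕ => ‖q‖ ^ m * (1 / (1 - ‖q‖)) :=
    (summable_geometric_of_lt_one (norm_nonneg q) hq).mul_right _
  refine Summable.of_norm_bounded hg fun m => ?_
  rw [lambertTerm_neg_natCast, norm_div, norm_div, norm_pow, norm_pow]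
  have h1 : 1 ≤ ‖(m : ℂ) + 1‖ ^ N := by
    apply one_le_pow₀
    have : ((m : ℂ) + 1) = ((m + 1 : ℕ) : ℂ) := by push_cast; rfl
    rw [this, Complex.norm_natCast]
    exact_mod_cast Nat.succ_le_succ (Nat.zero_le m)
  have hpos : 0 < 1 - ‖q‖ := by linarith
  have h2 : 1 - ‖q‖ ≤ ‖1 - q ^ (m + 1)‖ := by
    have h3 : ‖q‖ ^ (m + 1) ≤ ‖q‖ := pow_le_of_le_one (norm_nonneg q) hq.le (Nat.succ_ne_zero m)
    have h4 := norm_sub_norm_le (1 : ℂ) (q ^ (m + 1))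
    rw [norm_one, norm_pow] at h4
    linarith
  calc ‖q‖ ^ (m + 1) / ‖1 - q ^ (m + 1)‖ / ‖(m : ℂ) + 1‖ ^ N
      ≤ ‖q‖ ^ (m + 1) / ‖1 - q ^ (m + 1)‖ := div_le_self (by positivity) h1
    _ ≤ ‖q‖ ^ m / (1 - ‖q‖) := by
        apply div_le_div₀ (by positivity) _ hpos h2
        exact pow_le_pow_of_le_one (norm_nonneg q) hq.le (Nat.le_succ m)
    _ = ‖q‖ ^ m * (1 / (1 - ‖q‖)) := by ring

lemma norm_pow_lt_one_of_norm_lt_one {q : ℂ} (hq : ‖q‖ < 1) {a : ℕ} (ha : a ≠ 0) :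
    ‖q ^ a‖ < 1 := by
  rw [norm_pow]
  exact pow_lt_one₀ (norm_nonneg q) hq ha

/-! ### The Hecke relation at 2 -/

/-- Index 2t is the odd summation index n = 2t+1, so (-q)^n = -q^n and x/(1-x) - x/(1+x) =
2x²/(1-x²) with x = q^n. -/
lemma lambertTerm_add_neg_two_mul {q : ℂ} (hq : ‖q‖ < 1) (N t : ℕ) :
    lambertTerm q (-(N : ℂ)) (2 * t) + lambertTerm (-q) (-(N : ℂ)) (2 * t)
      - 2 * lambertTerm (q ^ 2) (-(N : ℂ)) (2 * t) = 0 := by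
  simp only [lambertTerm_neg_natCast]
  have e1 := one_sub_pow_ne_zero_of_norm_lt_one hq (2 * t)
  have e2 := one_sub_pow_ne_zero_of_norm_lt_one ((norm_neg q).trans_lt hq) (2 * t)
  have e3 := one_sub_pow_ne_zero_of_norm_lt_one
    (norm_pow_lt_one_of_norm_lt_one hq two_ne_zero) (2 * t)
  rw [← pow_mul, mul_comm 2 (2 * t + 1), pow_mul] at e3 ⊢
  rw [Odd.neg_pow ⟨t, rfl⟩ q] at e2 ⊢
  generalize q ^ (2 * t + 1) = x at *
  generalize (((2 * t : ℕ) : ℂ) + 1) ^ N = y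
  have : x / (1 - x) + -x / (1 - -x) - 2 * (x ^ 2 / (1 - x ^ 2)) = 0 := by
    rw [div_add_div _ _ e1 e2, ← mul_div_assoc, div_sub_div _ _ (mul_ne_zero e1 e2) e3]
    exact div_eq_zero_iff.mpr (Or.inl (by ring))
  linear_combination this / y

/-- Here n = 2(t+1) is even, so q and -q contribute equally. The factor 2 in n comes out as 2^{-N}
and turns q^n into (q²)^{t+1}. -/
lemma lambertTerm_add_neg_two_mul_add_one (q : ℂ) (N t : ℕ) :
    lambertTerm q (-(N : ℂ)) (2 * t + 1) + lambertTerm (-q) (-(N : ℂ)) (2 * t + 1)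
      - 2 * lambertTerm (q ^ 2) (-(N : ℂ)) (2 * t + 1) =
      2 / 2 ^ N * (lambertTerm (q ^ 2) (-(N : ℂ)) t - lambertTerm (q ^ 4) (-(N : ℂ)) t) := by
  simp only [lambertTerm_neg_natCast]
  have heven : (-q) ^ (2 * t + 1 + 1) = q ^ (2 * t + 1 + 1) := Even.neg_pow ⟨t + 1, by ring⟩ q
  have hc : (((2 * t + 1 : ℕ) : ℂ) + 1) ^ N = 2 ^ N * ((t : ℂ) + 1) ^ N := by
    rw [← mul_pow]; push_cast; ring
  rw [heven, hc, ← pow_mul, ← pow_mul, ← pow_mul, show 2 * t + 1 + 1 = 2 * (t + 1) by ring,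
    show 2 * (2 * (t + 1)) = 4 * (t + 1) by ring]
  generalize q ^ (2 * (t + 1)) = x
  generalize q ^ (4 * (t + 1)) = y
  generalize ((t : ℂ) + 1) ^ N = u
  rw [← div_div, ← div_div]
  ring

/-- The relation between Lambert series at `q`, `-q`, `q ^ 2` and `q ^ 4` that comes from the Hecke
operator at `2`. -/
lemma lambertL_add_lambertL_neg {q : ℂ} (hq : ‖q‖ < 1) (N : ℕ) :
    lambertL q (-(N : ℂ)) + lambertL (-q) (-(N : ℂ)) =
      (2 + 2 / 2 ^ N) * lambertL (q ^ 2) (-(N : ℂ)) -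
        2 / 2 ^ N * lambertL (q ^ 4) (-(N : ℂ)) := by
  have s1 := summable_lambertTerm_neg_natCast hq N
  have s2 := summable_lambertTerm_neg_natCast ((norm_neg q).trans_lt hq) N
  have s3 := summable_lambertTerm_neg_natCast (norm_pow_lt_one_of_norm_lt_one hq two_ne_zero) N
  have s4 := summable_lambertTerm_neg_natCast (norm_pow_lt_one_of_norm_lt_one hq four_ne_zero) N
  have key := tsum_even_add_odd
    (f := fun m => lambertTerm q (-(N : ℂ)) m + lambertTerm (-q) (-(N : ℂ)) m
      - 2 * lambertTerm (q ^ 2) (-(N : ℂ)) m)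
    (by simpa only [lambertTerm_add_neg_two_mul hq] using summable_zero)
    (by simpa only [lambertTerm_add_neg_two_mul_add_one] using (s3.sub s4).mul_left _)
  simp only [lambertTerm_add_neg_two_mul hq, lambertTerm_add_neg_two_mul_add_one,
    tsum_zero, zero_add, tsum_mul_left] at key
  rw [s3.tsum_sub s4, (s1.add s2).tsum_sub (s3.mul_left 2), s1.tsum_add s2, tsum_mul_left] at key
  unfold lambertL
  linear_combination -key

/-! ### The cotangent double series and its reflection -/

/-- The double series `∑_{m, j ≥ 1} 1 / (m ^ (2 n) (m ^ 2 z ^ 2 - j ^ 2))`. -/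
noncomputable def cotDoubleTerm (n : ℕ) (z : ℂ) (p : ℕ × ℕ) : ℂ :=
  1 / (((p.1 : ℂ) + 1) ^ (2 * n) * (((p.1 : ℂ) + 1) ^ 2 * z ^ 2 - ((p.2 : ℂ) + 1) ^ 2))

/-- Multiplying mz - j by the conjugate of z makes the m-term real, so the imaginary part is j·Im z;
the bound is uniform in m. -/
lemma le_norm_mul_sub_ofReal (z : ℂ) (m j : ℝ) : |j| * |z.im| ≤ ‖m * z - j‖ * ‖z‖ := by
  have h := Complex.abs_im_le_norm ((m * z - j) * (starRingEnd ℂ) z)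
  rw [norm_mul, Complex.norm_conj] at h
  convert h using 1
  rw [← abs_mul]
  congr 1
  simp
  ring

lemma norm_sq_mul_sq_sub_sq_ge (z : ℂ) (m j : ℝ) :
    (j * z.im) ^ 2 ≤ ‖(m : ℂ) ^ 2 * z ^ 2 - (j : ℂ) ^ 2‖ * ‖z‖ ^ 2 := by
  have h1 := le_norm_mul_sub_ofReal z m j
  have h2 := le_norm_mul_sub_ofReal z m (-j)
  rw [abs_neg] at h2
  have h3 : (m : ℂ) ^ 2 * z ^ 2 - (j : ℂ) ^ 2 = (m * z - j) * (m * z - (-j : ℝ)) := by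
    push_cast; ring
  rw [h3, norm_mul]
  calc (j * z.im) ^ 2 = (|j| * |z.im|) * (|j| * |z.im|) := by
        rw [← abs_mul, abs_mul_abs_self]; ring
    _ ≤ _ := mul_le_mul h1 h2 (by positivity) (by positivity)
    _ = _ := by ring

lemma sq_mul_sq_sub_sq_ne_zero {z : ℂ} (hz : z.im ≠ 0) (m j : ℕ) :
    ((m : ℂ) + 1) ^ 2 * z ^ 2 - ((j : ℂ) + 1) ^ 2 ≠ 0 := by
  intro h
  have h1 := norm_sq_mul_sq_sub_sq_ge z (m + 1) (j + 1)
  push_cast at h1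
  rw [h, norm_zero, zero_mul] at h1
  have : 0 < (((j : ℝ) + 1) * z.im) ^ 2 := by positivity
  linarith

lemma summable_one_div_add_one_pow {N : ℕ} (hN : 2 ≤ N) :
    Summable fun m : ℕ => 1 / ((m : ℂ) + 1) ^ N := by
  have := (summable_nat_add_iff 1).mpr
    (Complex.summable_one_div_nat_cpow (p := N).mpr (by simpa using (by lia : 1 < N)))
  simpa using this

lemma tsum_one_div_add_one_pow {N : ℕ} (hN : 2 ≤ N) :
    ∑' m : ℕ, 1 / ((m : ℂ) + 1) ^ N = riemannZeta N := by
  rw [zeta_eq_tsum_one_div_nat_add_one_cpow (by simpa using (by lia : 1 < N))]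
  simp

/-- The uniform bound dominates the series by a multiple of ∑ 1/m² · ∑ 1/j². Absolute convergence is
what later permits exchanging m and j. -/
lemma summable_cotDoubleTerm {n : ℕ} (hn : 1 ≤ n) {z : ℂ} (hz : z.im ≠ 0) :
    Summable (cotDoubleTerm n z) := by
  have h2 : Summable fun m : ℕ => ‖1 / ((m : ℂ) + 1) ^ 2‖ :=
    (summable_one_div_add_one_pow le_rfl).norm
  have hprod := (h2.mul_of_nonneg h2 (fun _ => norm_nonneg _) (fun _ => norm_nonneg _)).mul_left
    (‖z‖ ^ 2 / z.im ^ 2)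
  refine Summable.of_norm_bounded hprod fun p => ?_
  obtain ⟨m, j⟩ := p
  have hm : ‖(m : ℂ) + 1‖ = (m : ℝ) + 1 := by
    exact_mod_cast Complex.norm_natCast (m + 1)
  have hj : ‖(j : ℂ) + 1‖ = (j : ℝ) + 1 := by
    exact_mod_cast Complex.norm_natCast (j + 1)
  simp only [cotDoubleTerm, norm_div, norm_mul, norm_pow, norm_one, hm, hj]
  have h1 := norm_sq_mul_sq_sub_sq_ge z (m + 1) (j + 1)
  push_cast at h1
  have hne := norm_pos_iff.mpr (sq_mul_sq_sub_sq_ne_zero hz m j)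
  have hpow : ((m : ℝ) + 1) ^ 2 ≤ ((m : ℝ) + 1) ^ (2 * n) :=
    pow_le_pow_right₀ (by linarith [Nat.cast_nonneg (α := ℝ) m]) (by lia)
  set A := ‖((m : ℂ) + 1) ^ 2 * z ^ 2 - ((j : ℂ) + 1) ^ 2‖
  calc 1 / (((m : ℝ) + 1) ^ (2 * n) * A) ≤ 1 / (((m : ℝ) + 1) ^ 2 * A) := by gcongr
    _ ≤ _ := by
      rw [div_mul_div_comm, div_mul_div_comm, div_le_div_iff₀ (by positivity) (by positivity)]
      have : 0 ≤ ((m : ℝ) + 1) ^ 2 := by positivity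
      nlinarith [mul_le_mul_of_nonneg_left h1 this]

/-- The Mittag-Leffler expansion of π cot at mz, with the poles at j and -j paired. -/
lemma pi_mul_cot_pi_mul_eq_tsum {z : ℂ} (hz : z.im ≠ 0) (n m : ℕ) :
    Real.pi * Complex.cot (Real.pi * (((m : ℂ) + 1) * z)) / ((m : ℂ) + 1) ^ (2 * n + 1) =
      1 / z * (1 / ((m : ℂ) + 1) ^ (2 * n + 2)) + 2 * z * ∑' j : ℕ, cotDoubleTerm n z (m, j) := by
  have hm : (m : ℂ) + 1 ≠ 0 := Nat.cast_add_one_ne_zero m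
  have hz0 : z ≠ 0 := by rintro rfl; simp at hz
  have hw : ((m : ℂ) + 1) * z ∈ Complex.integerComplement := by
    rw [Complex.mem_integerComplement_iff]
    rintro ⟨l, hl⟩
    have := congrArg Complex.im hl
    simp at this
    rcases this with h | h
    · exact absurd h (by positivity)
    · exact hz h
  have h := cot_series_rep' hw
  rw [← tsum_mul_left]
  have hterm (j : ℕ) : 2 * z * cotDoubleTerm n z (m, j) = 1 / ((m : ℂ) + 1) ^ (2 * n + 1) *
      (1 / (((m : ℂ) + 1) * z - (j + 1)) + 1 / (((m : ℂ) + 1) * z + (j + 1))) := by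
    have hne := sq_mul_sq_sub_sq_ne_zero hz m j
    have hf : ((m : ℂ) + 1) ^ 2 * z ^ 2 - ((j : ℂ) + 1) ^ 2 =
      (((m : ℂ) + 1) * z - (j + 1)) * (((m : ℂ) + 1) * z + (j + 1)) := by ring
    simp only [cotDoubleTerm]
    rw [hf] at hne ⊢
    have h1 := left_ne_zero_of_mul hne
    have h2 := right_ne_zero_of_mul hne
    rw [div_add_div _ _ h1 h2]
    field_simp
    ring
  simp only [hterm]
  rw [tsum_mul_left, ← h]
  field_simp
  ring

lemma tsum_pi_mul_cot_pi_mul {n : ℕ} (hn : 1 ≤ n) {z : ℂ} (hz : z.im ≠ 0) :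
    ∑' m : ℕ, Real.pi * Complex.cot (Real.pi * (((m : ℂ) + 1) * z)) / ((m : ℂ) + 1) ^ (2 * n + 1) =
      riemannZeta (2 * n + 2 : ℕ) / z + 2 * z * ∑' p : ℕ × ℕ, cotDoubleTerm n z p := by
  have hs := summable_cotDoubleTerm hn hz
  simp only [pi_mul_cot_pi_mul_eq_tsum hz]
  rw [((summable_one_div_add_one_pow (by lia)).mul_left _).tsum_add (hs.prod.mul_left _),
    tsum_mul_left, tsum_mul_left, tsum_one_div_add_one_pow (by lia), hs.tsum_prod]
  ring

/-- With a = m+1 and b = j+1, both terms have the denominator a²z² - b² up to a factor, and the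
combined numerator is a multiple of (a²z²)^n - (b²)^n. The quotient is a finite geometric sum in
which a and b separate. -/
lemma cotDoubleTerm_reflection (n : ℕ) {z : ℂ} (hz : z.im ≠ 0) (m j : ℕ) :
    z ^ (2 * n) * cotDoubleTerm n z⁻¹ (j, m) + z ^ 2 * cotDoubleTerm n z (m, j) =
      -∑ i ∈ Finset.range n, z ^ (2 * (i + 1)) *
        (1 / ((m : ℂ) + 1) ^ (2 * (n - i)) * (1 / ((j : ℂ) + 1) ^ (2 * (i + 1)))) := by
  have hne := sq_mul_sq_sub_sq_ne_zero hz m j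
  have hz0 : z ≠ 0 := by rintro rfl; simp at hz
  have hm : (m : ℂ) + 1 ≠ 0 := Nat.cast_add_one_ne_zero m
  have hj : (j : ℂ) + 1 ≠ 0 := Nat.cast_add_one_ne_zero j
  simp only [cotDoubleTerm, pow_mul]
  generalize (m : ℂ) + 1 = a at *
  generalize (j : ℂ) + 1 = b at *
  have hinv : b ^ 2 * z⁻¹ ^ 2 - a ^ 2 = -(a ^ 2 * z ^ 2 - b ^ 2) / z ^ 2 := by
    field_simp
    ring
  have hgeom := (Commute.all (a ^ 2 * z ^ 2) (b ^ 2)).geom_sum₂_mul n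
  have hsum : ∑ i ∈ Finset.range n, (z ^ 2) ^ (i + 1) *
        (1 / (a ^ 2) ^ (n - i) * (1 / (b ^ 2) ^ (i + 1))) =
      z ^ 2 / ((a ^ 2) ^ n * (b ^ 2) ^ n) *
        ∑ i ∈ Finset.range n, (a ^ 2 * z ^ 2) ^ i * (b ^ 2) ^ (n - 1 - i) := by
    rw [Finset.mul_sum]
    refine Finset.sum_congr rfl fun i hi => ?_
    have hin := Finset.mem_range.mp hi
    obtain ⟨d, rfl⟩ : ∃ d, n = i + 1 + d := ⟨n - (i + 1), by lia⟩
    rw [show i + 1 + d - i = d + 1 by lia, show i + 1 + d - 1 - i = d by lia]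
    field_simp
    ring
  rw [hsum, eq_div_of_mul_eq hne hgeom, hinv, mul_pow]
  field_simp
  ring

lemma tsum_cotDoubleTerm_reflection {n : ℕ} (hn : 1 ≤ n) {z : ℂ} (hz : z.im ≠ 0) :
    z ^ (2 * n) * ∑' p, cotDoubleTerm n z⁻¹ p + z ^ 2 * ∑' p, cotDoubleTerm n z p =
      -∑ i ∈ Finset.range n, z ^ (2 * (i + 1)) *
        (riemannZeta (2 * (n - i) : ℕ) * riemannZeta (2 * (i + 1) : ℕ)) := by
  have hz' : (z⁻¹).im ≠ 0 := by
    have hz0 : z ≠ 0 := by rintro rfl; simp at hz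
    rw [Complex.inv_im]
    exact div_ne_zero (neg_ne_zero.mpr hz) (Complex.normSq_pos.mpr hz0).ne'
  have hs := summable_cotDoubleTerm hn hz
  have hs' := summable_cotDoubleTerm hn hz'
  have hsw : Summable fun p : ℕ × ℕ => cotDoubleTerm n z⁻¹ p.swap :=
    (Equiv.prodComm ℕ ℕ).summable_iff.mpr hs'
  have htw : ∑' p : ℕ × ℕ, cotDoubleTerm n z⁻¹ p.swap = ∑' p, cotDoubleTerm n z⁻¹ p :=
    (Equiv.prodComm ℕ ℕ).tsum_eq (cotDoubleTerm n z⁻¹)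
  rw [← htw, ← tsum_mul_left, ← tsum_mul_left, ← (hsw.mul_left _).tsum_add (hs.mul_left _)]
  have hterm (p : ℕ × ℕ) := cotDoubleTerm_reflection n hz p.1 p.2
  simp only [Prod.swap, hterm]
  have hsi : ∀ i ∈ Finset.range n, Summable fun p : ℕ × ℕ => z ^ (2 * (i + 1)) *
        (1 / ((p.1 : ℂ) + 1) ^ (2 * (n - i)) * (1 / ((p.2 : ℂ) + 1) ^ (2 * (i + 1)))) := by
    intro i hi
    have hin := Finset.mem_range.mp hi
    exact (summable_mul_of_summable_norm (summable_one_div_add_one_pow (by lia)).norm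
      (summable_one_div_add_one_pow (by lia)).norm).mul_left _
  rw [tsum_neg, Summable.tsum_finsetSum hsi]
  congr 1
  refine Finset.sum_congr rfl fun i hi => ?_
  have hin := Finset.mem_range.mp hi
  rw [tsum_mul_left, ← tsum_mul_tsum_of_summable_norm
    (summable_one_div_add_one_pow (by lia)).norm (summable_one_div_add_one_pow (by lia)).norm,
    tsum_one_div_add_one_pow (by lia), tsum_one_div_add_one_pow (by lia)]

/-! ### Even zeta values and Ramanujan's formula -/

/-- Euler's formula extends to j = 0 because ζ(0) = -1/2; this lets the Bernoulli sum include its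
two end terms. -/
lemma riemannZeta_even_eq_bernoulli (j : ℕ) :
    riemannZeta (2 * j : ℕ) =
      (-1) ^ (j + 1) * (2 * (Real.pi : ℂ)) ^ (2 * j) / 2 *
        ((bernoulli (2 * j) : ℂ) / ((2 * j).factorial : ℂ)) := by
  rcases Nat.eq_zero_or_pos j with rfl | hj
  · simp [riemannZeta_zero]
  · push_cast
    rw [riemannZeta_two_mul_nat hj.ne']
    obtain ⟨d, hd⟩ : ∃ d, 2 * j = d + 1 := ⟨2 * j - 1, by lia⟩
    rw [mul_pow, hd, Nat.add_sub_cancel, pow_succ (2 : ℂ)]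
    ring

lemma riemannZeta_mul_riemannZeta_even {n j : ℕ} (hj : j ≤ n) :
    riemannZeta (2 * j : ℕ) * riemannZeta (2 * (n - j) : ℕ) =
      (-1) ^ n * (2 * (Real.pi : ℂ)) ^ (2 * n) / 4 *
        ((bernoulli (2 * j) : ℂ) * (bernoulli (2 * (n - j)) : ℂ) /
          (((2 * j).factorial : ℂ) * ((2 * (n - j)).factorial : ℂ))) := by
  rw [riemannZeta_even_eq_bernoulli, riemannZeta_even_eq_bernoulli]
  obtain ⟨d, rfl⟩ := Nat.exists_eq_add_of_le hj
  rw [Nat.add_sub_cancel_left]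
  ring

lemma norm_exp_two_pi_I_mul_lt_one {z : ℂ} (hz : 0 < z.im) :
    ‖Complex.exp (2 * Real.pi * Complex.I * z)‖ < 1 := by
  rw [Complex.norm_exp, Real.exp_lt_one_iff]
  simp only [Complex.mul_re, Complex.mul_im, Complex.re_ofNat, Complex.im_ofNat, Complex.ofReal_re,
    Complex.ofReal_im, Complex.I_re, Complex.I_im]
  have := mul_pos Real.pi_pos hz
  linarith

/-- The Lambert series at `-N` completed by the constant term `ζ(N) / 2`. -/
noncomputable def completedLambert (q : ℂ) (N : ℕ) : ℂ :=
  riemannZeta N / 2 + lambertL q (-(N : ℂ))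

lemma completedLambert_add_neg {q : ℂ} (hq : ‖q‖ < 1) (N : ℕ) :
    completedLambert q N + completedLambert (-q) N =
      (2 + 2 / 2 ^ N) * completedLambert (q ^ 2) N - 2 / 2 ^ N * completedLambert (q ^ 4) N := by
  unfold completedLambert
  linear_combination lambertL_add_lambertL_neg hq N

/-- With x = e^{2πiw}, π cot(πw) = -2πi(1/2 + x/(1-x)). The constant 1/2 produces the term ζ(N)/2 of
the completion. -/
lemma tsum_pi_mul_cot_eq_completedLambert {z : ℂ} (hz : 0 < z.im) {N : ℕ} (hN : 2 ≤ N) :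
    ∑' m : ℕ, Real.pi * Complex.cot (Real.pi * (((m : ℂ) + 1) * z)) / ((m : ℂ) + 1) ^ N =
      -(2 * Real.pi * Complex.I) *
        completedLambert (Complex.exp (2 * Real.pi * Complex.I * z)) N := by
  have hq := norm_exp_two_pi_I_mul_lt_one hz
  have hterm (m : ℕ) : Real.pi * Complex.cot (Real.pi * (((m : ℂ) + 1) * z)) / ((m : ℂ) + 1) ^ N =
      -(2 * Real.pi * Complex.I) * (1 / 2 * (1 / ((m : ℂ) + 1) ^ N) +
        lambertTerm (Complex.exp (2 * Real.pi * Complex.I * z)) (-(N : ℂ)) m) := by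
    have hne := one_sub_pow_ne_zero_of_norm_lt_one hq m
    rw [lambertTerm_neg_natCast, Complex.cot_pi_eq_exp_ratio,
      show 2 * (Real.pi : ℂ) * Complex.I * (((m : ℂ) + 1) * z) =
        ((m + 1 : ℕ) : ℂ) * (2 * Real.pi * Complex.I * z) by push_cast; ring, Complex.exp_nat_mul]
    generalize Complex.exp (2 * Real.pi * Complex.I * z) ^ (m + 1) = x at *
    have h1 : (x + 1) / (Complex.I * (1 - x)) = -(2 * Complex.I) * (1 / 2 + x / (1 - x)) := by
      rw [div_eq_iff (mul_ne_zero Complex.I_ne_zero hne)]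
      field_simp
      linear_combination (x + 1) * Complex.I_sq
    rw [h1]
    ring
  simp only [hterm]
  rw [tsum_mul_left, ((summable_one_div_add_one_pow hN).mul_left _).tsum_add
    (summable_lambertTerm_neg_natCast hq N), tsum_mul_left, tsum_one_div_add_one_pow hN]
  unfold completedLambert lambertL
  ring

/-- Ramanujan's formula for `ζ(2 n + 1)`, as the transformation law of the completed Lambert series
under `z ↦ -1 / z`. -/
theorem completedLambert_sub_completedLambert_neg_inv {n : ℕ} (hn : 1 ≤ n) {z : ℂ}
    (hz : 0 < z.im) :
    completedLambert (Complex.exp (2 * Real.pi * Complex.I * z)) (2 * n + 1) -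
      z ^ (2 * n) *
        completedLambert (Complex.exp (2 * Real.pi * Complex.I * (-z⁻¹))) (2 * n + 1) =
      (-1) ^ n * Complex.I * (2 * (Real.pi : ℂ)) ^ (2 * n + 1) / 2 *
        ∑ j ∈ Finset.range (n + 2), z ^ (2 * j) / z *
          ((bernoulli (2 * j) : ℂ) * (bernoulli (2 * (n + 1 - j)) : ℂ) /
            (((2 * j).factorial : ℂ) * ((2 * (n + 1 - j)).factorial : ℂ))) := by
  have hz0 : z ≠ 0 := by rintro rfl; simp at hz
  have hpi : (Real.pi : ℂ) ≠ 0 := Complex.ofReal_ne_zero.mpr Real.pi_ne_zero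
  have him : 0 < (-z⁻¹).im := by
    rw [Complex.neg_im, Complex.inv_im, neg_div, neg_neg]
    exact div_pos hz (Complex.normSq_pos.mpr hz0)
  have him' : (z⁻¹).im ≠ 0 := by
    rw [Complex.neg_im] at him
    linarith
  have h1 := tsum_pi_mul_cot_eq_completedLambert hz (N := 2 * n + 1) (by lia)
  have h2 := tsum_pi_mul_cot_eq_completedLambert him (N := 2 * n + 1) (by lia)
  rw [tsum_pi_mul_cot_pi_mul hn hz.ne'] at h1
  -- Oddness of cot moves the series from -1/z to 1/z, the argument in the reflection identity.
  have cot_neg (w : ℂ) : Complex.cot (-w) = -Complex.cot w := by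
    rw [Complex.cot, Complex.cot, Complex.cos_neg, Complex.sin_neg, div_neg]
  simp only [mul_neg, cot_neg, neg_div, tsum_neg] at h2
  rw [tsum_pi_mul_cot_pi_mul hn him'] at h2
  have h3 := tsum_cotDoubleTerm_reflection hn hz.ne'
  -- The terms j = 0 and j = n+1 carry ζ(0) = -1/2 and account for the single ζ(2n+2) terms of the
  -- two cotangent sums.
  have hsum : ∑ j ∈ Finset.range (n + 2), z ^ (2 * j) / z *
      (riemannZeta (2 * j : ℕ) * riemannZeta (2 * (n + 1 - j) : ℕ)) =
      (∑ i ∈ Finset.range n, z ^ (2 * (i + 1)) *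
        (riemannZeta (2 * (n - i) : ℕ) * riemannZeta (2 * (i + 1) : ℕ))) / z
      - (1 / z + z ^ (2 * n + 1)) * riemannZeta (2 * n + 2 : ℕ) / 2 := by
    rw [Finset.sum_range_succ, Finset.sum_range_succ', Finset.sum_div]
    have : ∀ i ∈ Finset.range n, z ^ (2 * (i + 1)) / z *
        (riemannZeta (2 * (i + 1) : ℕ) * riemannZeta (2 * (n + 1 - (i + 1)) : ℕ)) =
        z ^ (2 * (i + 1)) *
        (riemannZeta (2 * (n - i) : ℕ) * riemannZeta (2 * (i + 1) : ℕ)) / z := by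
      intro i _
      rw [Nat.add_sub_add_right]
      ring
    rw [Finset.sum_congr rfl this]
    have hzeta : riemannZeta (0 : ℕ) = -1 / 2 := by rw [Nat.cast_zero, riemannZeta_zero]
    simp only [Nat.sub_self, mul_zero, Nat.sub_zero, hzeta]
    rw [show 2 * (n + 1) = 2 * n + 2 by ring]
    field_simp
    ring
  have hB : ∀ j ∈ Finset.range (n + 2), z ^ (2 * j) / z *
      (riemannZeta (2 * j : ℕ) * riemannZeta (2 * (n + 1 - j) : ℕ)) =
      (-1) ^ (n + 1) * (2 * (Real.pi : ℂ)) ^ (2 * (n + 1)) / 4 * (z ^ (2 * j) / z *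
          ((bernoulli (2 * j) : ℂ) * (bernoulli (2 * (n + 1 - j)) : ℂ) /
            (((2 * j).factorial : ℂ) * ((2 * (n + 1 - j)).factorial : ℂ)))) := by
    intro j hj
    rw [riemannZeta_mul_riemannZeta_even (by have := Finset.mem_range.mp hj; lia)]
    ring
  rw [Finset.sum_congr rfl hB, ← Finset.mul_sum] at hsum
  rw [mul_neg (2 * (Real.pi : ℂ) * Complex.I) z⁻¹]
  generalize completedLambert (Complex.exp (2 * Real.pi * Complex.I * z)) (2 * n + 1) = X at *
  generalize completedLambert (Complex.exp (-(2 * Real.pi * Complex.I * z⁻¹))) (2 * n + 1) = Y at *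
  generalize (∑ j ∈ Finset.range (n + 2), z ^ (2 * j) / z *
          ((bernoulli (2 * j) : ℂ) * (bernoulli (2 * (n + 1 - j)) : ℂ) /
            (((2 * j).factorial : ℂ) * ((2 * (n + 1 - j)).factorial : ℂ)))) = B at *
  generalize (∑ i ∈ Finset.range n, z ^ (2 * (i + 1)) *
        (riemannZeta (2 * (n - i) : ℕ) * riemannZeta (2 * (i + 1) : ℕ))) = Z at *
  generalize ∑' p, cotDoubleTerm n z p = S at *
  generalize ∑' p, cotDoubleTerm n z⁻¹ p = T at *
  generalize riemannZeta (2 * n + 2 : ℕ) = W at *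
  rw [div_inv_eq_mul] at h2
  have key : -(2 * Real.pi * Complex.I) * (X - z ^ (2 * n) * Y) =
      -2 * (Z / z - (1 / z + z ^ (2 * n + 1)) * W / 2) := by
    have h4 : Z = -(z ^ (2 * n) * T + z ^ 2 * S) := by rw [h3, neg_neg]
    rw [h4]
    field_simp
    field_simp at h1 h2
    linear_combination z ^ (2 * n) * h2 - h1
  rw [← hsum] at key
  have hI := Complex.I_sq
  have : (2 * Real.pi : ℂ) * (X - z ^ (2 * n) * Y -
      (-1) ^ n * Complex.I * (2 * (Real.pi : ℂ)) ^ (2 * n + 1) / 2 * B) = 0 := by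
    linear_combination Complex.I * key + (2 * Real.pi * (X - z ^ (2 * n) * Y)) * hI
  rcases mul_eq_zero.mp this with h | h
  · exact absurd h (mul_ne_zero two_ne_zero hpi)
  · exact sub_eq_zero.mp h

/-! ### The points (±1+√-7)/4 -/

lemma cos_thetaSeven : Real.cos thetaSeven = √7 / √8 := by
  rw [thetaSeven, arccot, Real.cos_pi_div_two_sub, Real.sin_arctan, Real.sq_sqrt (by norm_num)]
  norm_num

lemma sin_thetaSeven : Real.sin thetaSeven = 1 / √8 := by
  rw [thetaSeven, arccot, Real.sin_pi_div_two_sub, Real.cos_arctan, Real.sq_sqrt (by norm_num)]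
  norm_num

lemma sqrt_two_mul_exp_thetaSeven :
    (√2 : ℂ) * Complex.exp (thetaSeven * Complex.I) = (√7 + Complex.I) / 2 := by
  rw [Complex.exp_mul_I, ← Complex.ofReal_cos, ← Complex.ofReal_sin, cos_thetaSeven,
    sin_thetaSeven, show √8 = 2 * √2 by
      rw [show (8 : ℝ) = 2 ^ 2 * 2 by norm_num, Real.sqrt_mul (by norm_num),
        Real.sqrt_sq (by norm_num)]]
  have : (√2 : ℂ) ≠ 0 := by simp
  push_cast
  field_simp

lemma sqrt_two_mul_exp_neg_thetaSeven :
    (√2 : ℂ) * Complex.exp (-(thetaSeven * Complex.I)) = (√7 - Complex.I) / 2 := by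
  have h := congrArg (starRingEnd ℂ) sqrt_two_mul_exp_thetaSeven
  rw [map_mul, ← Complex.exp_conj, map_mul, map_div₀, map_add] at h
  simpa [sub_eq_add_neg, map_ofNat] using h

lemma ofReal_sqrt_sq {x : ℝ} (hx : 0 ≤ x) : (√x : ℂ) ^ 2 = x := by
  exact_mod_cast Real.sq_sqrt hx

/-- Polar form: modulus 1/√2, argument π/2 - θ. The companion point has argument π/2 + θ, so sums of
powers over both points are cosines. -/
lemma one_add_sqrt_neg_seven_eq :
    (1 + √7 * Complex.I) / 4 =
      Complex.I / √2 * Complex.exp (-(thetaSeven * Complex.I)) := by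
  have h2 : (√2 : ℂ) ≠ 0 := by simp
  have hs := ofReal_sqrt_sq (x := 2) (by norm_num)
  have h := sqrt_two_mul_exp_neg_thetaSeven
  have : Complex.exp (-(thetaSeven * Complex.I)) = (√7 - Complex.I) / 2 / √2 := by
    rw [← h]; field_simp
  rw [this, div_mul_div_comm, ← sq, hs]
  push_cast
  linear_combination (1 / 4 : ℂ) * Complex.I_sq

lemma neg_one_add_sqrt_neg_seven_eq :
    (-1 + √7 * Complex.I) / 4 =
      Complex.I / √2 * Complex.exp (thetaSeven * Complex.I) := by
  have h2 : (√2 : ℂ) ≠ 0 := by simp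
  have hs := ofReal_sqrt_sq (x := 2) (by norm_num)
  have h := sqrt_two_mul_exp_thetaSeven
  have : Complex.exp (thetaSeven * Complex.I) = (√7 + Complex.I) / 2 / √2 := by
    rw [← h]; field_simp
  rw [this, div_mul_div_comm, ← sq, hs]
  push_cast
  linear_combination (-1 / 4 : ℂ) * Complex.I_sq

lemma I_div_sqrt_two_mul_exp_pow (t : ℂ) (j : ℕ) :
    (Complex.I / √2 * Complex.exp (t * Complex.I)) ^ (2 * j) =
      (-1) ^ j / 2 ^ j * Complex.exp ((2 * j * t) * Complex.I) := by
  have hs := ofReal_sqrt_sq (x := 2) (by norm_num)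
  rw [mul_pow, pow_mul, div_pow, Complex.I_sq, hs, ← Complex.exp_nat_mul, div_pow]
  push_cast
  ring_nf

lemma I_div_sqrt_two_mul_exp_pow_div (t : ℂ) (j : ℕ) :
    (Complex.I / √2 * Complex.exp (t * Complex.I)) ^ (2 * j) /
        (Complex.I / √2 * Complex.exp (t * Complex.I)) =
      -Complex.I * √2 * ((-1) ^ j / 2 ^ j) * Complex.exp (((2 * j - 1) * t) * Complex.I) := by
  have h2 : (√2 : ℂ) ≠ 0 := by simp
  rw [I_div_sqrt_two_mul_exp_pow, div_eq_iff (by simp [Complex.exp_ne_zero])]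
  rw [show ((2 * j * t) * Complex.I) = ((2 * j - 1) * t) * Complex.I + t * Complex.I by ring,
    Complex.exp_add]
  field_simp
  linear_combination Complex.I_sq

lemma sqrt_neg_seven_pow_add (j : ℕ) :
    ((1 + √7 * Complex.I) / 4) ^ (2 * j) + ((-1 + √7 * Complex.I) / 4) ^ (2 * j) =
      2 * ((-1) ^ j / 2 ^ j) * (Real.cos (2 * j * thetaSeven) : ℂ) := by
  rw [one_add_sqrt_neg_seven_eq, neg_one_add_sqrt_neg_seven_eq, ← neg_mul,
    I_div_sqrt_two_mul_exp_pow, I_div_sqrt_two_mul_exp_pow, Complex.ofReal_cos, Complex.cos]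
  push_cast
  rw [show (2 * j * -(thetaSeven : ℂ)) * Complex.I = -(2 * j * thetaSeven) * Complex.I by ring]
  ring

lemma sqrt_neg_seven_pow_div_add (j : ℕ) :
    ((1 + √7 * Complex.I) / 4) ^ (2 * j) / ((1 + √7 * Complex.I) / 4) +
        ((-1 + √7 * Complex.I) / 4) ^ (2 * j) / ((-1 + √7 * Complex.I) / 4) =
      -(2 * Complex.I * √2) * ((-1) ^ j / 2 ^ j) *
        (Real.cos ((2 * j - 1) * thetaSeven) : ℂ) := by
  rw [one_add_sqrt_neg_seven_eq, neg_one_add_sqrt_neg_seven_eq, ← neg_mul,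
    I_div_sqrt_two_mul_exp_pow_div, I_div_sqrt_two_mul_exp_pow_div, Complex.ofReal_cos, Complex.cos]
  push_cast
  rw [show ((2 * j - 1) * -(thetaSeven : ℂ)) * Complex.I =
    -((2 * j - 1) * thetaSeven) * Complex.I by ring]
  ring

/-- Since |z|² = 1/2, -1/z is -2 times the conjugate of z, that is, twice the companion point. -/
lemma neg_inv_one_add_sqrt_neg_seven :
    -((1 + √7 * Complex.I) / 4)⁻¹ = (-1 + √7 * Complex.I) / 2 := by
  have hs := ofReal_sqrt_sq (x := 7) (by norm_num)
  rw [neg_eq_iff_eq_neg, inv_eq_iff_eq_inv]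
  refine eq_inv_of_mul_eq_one_left ?_
  push_cast at hs
  linear_combination (-(√7 : ℂ) ^ 2 / 8) * Complex.I_sq + (1 / 8 : ℂ) * hs

lemma neg_inv_neg_one_add_sqrt_neg_seven :
    -((-1 + √7 * Complex.I) / 4)⁻¹ = (1 + √7 * Complex.I) / 2 := by
  have hs := ofReal_sqrt_sq (x := 7) (by norm_num)
  rw [neg_eq_iff_eq_neg, inv_eq_iff_eq_inv]
  refine eq_inv_of_mul_eq_one_left ?_
  push_cast at hs
  linear_combination (-(√7 : ℂ) ^ 2 / 8) * Complex.I_sq + (1 / 8 : ℂ) * hs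

lemma exp_two_pi_I_mul_one_add_div_four :
    Complex.exp (2 * Real.pi * Complex.I * ((1 + √7 * Complex.I) / 4)) =
      Complex.I * Complex.exp (-(√7 * Real.pi / 2)) := by
  rw [show 2 * Real.pi * Complex.I * ((1 + √7 * Complex.I) / 4) =
    (Real.pi / 2 * Complex.I) + (-(√7 * Real.pi / 2)) by
      linear_combination (Real.pi * √7 / 2 : ℂ) * Complex.I_sq, Complex.exp_add,
    Complex.exp_pi_div_two_mul_I]

lemma exp_two_pi_I_mul_neg_one_add_div_four :
    Complex.exp (2 * Real.pi * Complex.I * ((-1 + √7 * Complex.I) / 4)) =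
      -(Complex.I * Complex.exp (-(√7 * Real.pi / 2))) := by
  rw [show 2 * Real.pi * Complex.I * ((-1 + √7 * Complex.I) / 4) =
    -(Real.pi / 2 * Complex.I) + (-(√7 * Real.pi / 2)) by
      linear_combination (Real.pi * √7 / 2 : ℂ) * Complex.I_sq, Complex.exp_add,
    Complex.exp_neg, Complex.exp_pi_div_two_mul_I, Complex.inv_I, neg_mul]

lemma exp_two_pi_I_mul_one_add_div_two :
    Complex.exp (2 * Real.pi * Complex.I * ((1 + √7 * Complex.I) / 2)) =
      -Complex.exp (-(√7 * Real.pi)) := by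
  rw [show 2 * Real.pi * Complex.I * ((1 + √7 * Complex.I) / 2) =
    (Real.pi * Complex.I) + (-(√7 * Real.pi)) by
      linear_combination (Real.pi * √7 : ℂ) * Complex.I_sq, Complex.exp_add,
    Complex.exp_pi_mul_I, neg_one_mul]

lemma exp_two_pi_I_mul_neg_one_add_div_two :
    Complex.exp (2 * Real.pi * Complex.I * ((-1 + √7 * Complex.I) / 2)) =
      -Complex.exp (-(√7 * Real.pi)) := by
  rw [show 2 * Real.pi * Complex.I * ((-1 + √7 * Complex.I) / 2) =
    -(Real.pi * Complex.I) + (-(√7 * Real.pi)) by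
      linear_combination (Real.pi * √7 : ℂ) * Complex.I_sq, Complex.exp_add,
    Complex.exp_neg, Complex.exp_pi_mul_I, inv_neg_one, neg_one_mul]

/-- Ramanujan's formula with n = 2k, summed over the two points. Their images under inversion share
one nome, so the factors z^{4k} add up to a single cosine. -/
lemma completedLambert_I_mul_add_neg {k : ℕ} (hk : 1 ≤ k) :
    completedLambert (Complex.I * Complex.exp (-(√7 * Real.pi / 2))) (4 * k + 1) +
        completedLambert (-(Complex.I * Complex.exp (-(√7 * Real.pi / 2)))) (4 * k + 1) -
      2 / 2 ^ (2 * k) * (Real.cos (4 * k * thetaSeven) : ℂ) *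
        completedLambert (-Complex.exp (-(√7 * Real.pi))) (4 * k + 1) =
      (2 * (Real.pi : ℂ)) ^ (4 * k + 1) * √2 * ∑ j ∈ Finset.range (2 * k + 2),
        (-1) ^ j / 2 ^ j * (Real.cos ((2 * j - 1) * thetaSeven) : ℂ) *
          ((bernoulli (2 * j) : ℂ) * (bernoulli (2 * (2 * k + 1 - j)) : ℂ) /
            (((2 * j).factorial : ℂ) * ((2 * (2 * k + 1 - j)).factorial : ℂ))) := by
  have h1 := completedLambert_sub_completedLambert_neg_inv (n := 2 * k) (by lia)
    (z := (1 + √7 * Complex.I) / 4) (by simp)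
  have h2 := completedLambert_sub_completedLambert_neg_inv (n := 2 * k) (by lia)
    (z := (-1 + √7 * Complex.I) / 4) (by simp)
  rw [neg_inv_one_add_sqrt_neg_seven, exp_two_pi_I_mul_neg_one_add_div_two,
    exp_two_pi_I_mul_one_add_div_four] at h1
  rw [neg_inv_neg_one_add_sqrt_neg_seven, exp_two_pi_I_mul_one_add_div_two,
    exp_two_pi_I_mul_neg_one_add_div_four] at h2
  have hpow := sqrt_neg_seven_pow_add (2 * k)
  rw [Even.neg_one_pow ⟨k, by ring⟩] at h1 h2 hpow
  rw [show (2 * ((2 * k : ℕ) : ℝ) * thetaSeven) = 4 * k * thetaSeven by push_cast; ring] at hpow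
  have hsum := congrArg₂ (· + ·) h1 h2
  simp only [← mul_add, ← Finset.sum_add_distrib, ← add_mul, sqrt_neg_seven_pow_div_add] at hsum
  rw [show 2 * (2 * k) + 1 = 4 * k + 1 by ring] at hsum
  have hfac : ∑ j ∈ Finset.range (2 * k + 2), -(2 * Complex.I * √2) * ((-1) ^ j / 2 ^ j) *
        (Real.cos ((2 * j - 1) * thetaSeven) : ℂ) *
          ((bernoulli (2 * j) : ℂ) * (bernoulli (2 * (2 * k + 1 - j)) : ℂ) /
            (((2 * j).factorial : ℂ) * ((2 * (2 * k + 1 - j)).factorial : ℂ))) =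
      -(2 * Complex.I * √2) * ∑ j ∈ Finset.range (2 * k + 2),
        (-1) ^ j / 2 ^ j * (Real.cos ((2 * j - 1) * thetaSeven) : ℂ) *
          ((bernoulli (2 * j) : ℂ) * (bernoulli (2 * (2 * k + 1 - j)) : ℂ) /
            (((2 * j).factorial : ℂ) * ((2 * (2 * k + 1 - j)).factorial : ℂ))) := by
    rw [Finset.mul_sum]
    exact Finset.sum_congr rfl fun j _ => by ring
  rw [hfac] at hsum
  clear h1 h2 hfac
  generalize (∑ j ∈ Finset.range (2 * k + 2), _ : ℂ) = S at *
  generalize completedLambert (-Complex.exp (-(√7 * Real.pi))) (4 * k + 1) = Y at *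
  generalize (Real.cos (4 * k * thetaSeven) : ℂ) = C at *
  linear_combination hsum + Y * hpow -
    (2 * (Real.pi : ℂ)) ^ (4 * k + 1) * √2 * S * Complex.I_sq

/-! ### The coefficients and the conclusion -/

lemma sum_range_two_mul_eq_sum_add_reflect (f : ℕ → ℂ) (k : ℕ) :
    ∑ j ∈ Finset.range (2 * k + 2), f j =
      ∑ j ∈ Finset.range (k + 1), (f j + f (2 * k + 1 - j)) := by
  rw [Finset.sum_add_distrib, show 2 * k + 2 = (k + 1) + (k + 1) by ring,
    Finset.sum_range_add, ← Finset.sum_range_reflect (fun j => f (k + 1 + j))]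
  congr 1
  refine Finset.sum_congr rfl fun j hj => ?_
  have := Finset.mem_range.mp hj
  congr 1
  lia

/-- For k ≥ 1 the factor 2^{-2k} is below 1; at k = 0 and x = 0 the expression would vanish. -/
lemma one_sub_cos_div_pos {k : ℕ} (hk : 1 ≤ k) (x : ℝ) : 0 < 1 - 1 / 2 ^ (2 * k) * Real.cos x := by
  have h1 : (1 : ℝ) / 2 ^ (2 * k) < 1 := by
    rw [div_lt_one (by positivity)]
    exact one_lt_pow₀ (by norm_num) (by lia)
  have h2 : (0 : ℝ) < 1 / 2 ^ (2 * k) := by positivity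
  nlinarith [Real.cos_le_one x]

lemma two_zpow_eq_pow {x : ℤ} {k a : ℕ} (hx : x = -((2 * k * a : ℕ) : ℤ)) :
    (2 : ℝ) ^ x = (1 / 2 ^ (2 * k)) ^ a := by
  rw [hx, zpow_neg, zpow_natCast, one_div, inv_pow, ← pow_mul]

lemma coeffA_mul {k : ℕ} (hk : 1 ≤ k) :
    coeffA k * (1 - 1 / 2 ^ (2 * k) * Real.cos (4 * k * thetaSeven)) =
      2 + (1 / 2 ^ (2 * k)) ^ 2 - 2 * (1 / 2 ^ (2 * k)) * Real.cos (4 * k * thetaSeven) := by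
  have h := (one_sub_cos_div_pos hk (4 * k * thetaSeven)).ne'
  unfold coeffA
  rw [zpow_add₀ two_ne_zero, two_zpow_eq_pow (k := k) (a := 1) (x := -2 * k) (by push_cast; ring),
    two_zpow_eq_pow (k := k) (a := 2) (x := -4 * k) (by push_cast; ring), pow_one, zpow_one,
    div_mul_cancel₀ _ h]
  ring

lemma coeffB_mul {k : ℕ} (hk : 1 ≤ k) :
    coeffB k * (1 - 1 / 2 ^ (2 * k) * Real.cos (4 * k * thetaSeven)) =
      -(4 + 3 * (1 / 2 ^ (2 * k)) ^ 2 + (1 / 2 ^ (2 * k)) ^ 4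
        - 4 * (1 / 2 ^ (2 * k)) * Real.cos (4 * k * thetaSeven)
        - 2 * (1 / 2 ^ (2 * k)) ^ 3 * Real.cos (4 * k * thetaSeven)) := by
  have h := (one_sub_cos_div_pos hk (4 * k * thetaSeven)).ne'
  unfold coeffB
  rw [zpow_add₀ two_ne_zero, zpow_add₀ two_ne_zero,
    two_zpow_eq_pow (k := k) (a := 1) (x := -2 * k) (by push_cast; ring),
    two_zpow_eq_pow (k := k) (a := 2) (x := -4 * k) (by push_cast; ring),
    two_zpow_eq_pow (k := k) (a := 3) (x := -6 * k) (by push_cast; ring),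
    two_zpow_eq_pow (k := k) (a := 4) (x := -8 * k) (by push_cast; ring), pow_one, zpow_one,
    neg_mul, div_mul_cancel₀ _ h, show (2 : ℝ) ^ (2 : ℤ) = 4 by norm_num]
  ring

lemma coeffC_mul {k : ℕ} (hk : 1 ≤ k) (j : ℕ) :
    coeffC j k * (1 - 1 / 2 ^ (2 * k) * Real.cos (4 * k * thetaSeven)) =
      √2 * (1 / 2 ^ j * Real.cos ((2 * j - 1) * thetaSeven)
        - 2 ^ j / 2 ^ (2 * k + 1) * Real.cos ((4 * k + 1 - 2 * j) * thetaSeven)) := by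
  have h := one_sub_cos_div_pos hk (4 * k * thetaSeven)
  have hs : √2 * √2 = (2 : ℝ) := Real.mul_self_sqrt (by norm_num)
  have hs0 : √2 ≠ (0 : ℝ) := by simp
  have e1 : (2 : ℝ) ^ (2 * k + 1 / 2 - j : ℝ) = 2 ^ (2 * k) * √2 / 2 ^ j := by
    rw [Real.rpow_sub two_pos, Real.rpow_add two_pos, ← Real.sqrt_eq_rpow, Real.rpow_natCast]
    norm_cast
  have e2 : (2 : ℝ) ^ (j - 1 / 2 : ℝ) = 2 ^ j / √2 := by
    rw [Real.rpow_sub two_pos, ← Real.sqrt_eq_rpow, Real.rpow_natCast]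
  unfold coeffC
  rw [e1, e2]
  generalize Real.cos ((2 * j - 1) * thetaSeven) = x
  generalize Real.cos ((4 * k + 1 - 2 * j) * thetaSeven) = y
  generalize Real.cos (4 * k * thetaSeven) = C at *
  have hd : (2 : ℝ) ^ (2 * k) - C = 2 ^ (2 * k) * (1 - 1 / 2 ^ (2 * k) * C) := by
    field_simp
  rw [hd, div_mul_eq_mul_div, mul_div_mul_right _ _ h.ne', pow_succ (2 : ℝ) (2 * k)]
  field_simp
  linear_combination (y * 2 ^ j * 2 ^ j) * hs

/-- The Bernoulli product is symmetric under j ↦ 2k+1-j, so the sum folds in half; the two cosines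
in c_{jk} belong to j and to its mirror index. -/
lemma bernoulli_sum_eq_coeffC_sum {k : ℕ} (hk : 1 ≤ k) :
    √2 * ∑ j ∈ Finset.range (2 * k + 2),
        (-1) ^ j / 2 ^ j * (Real.cos ((2 * j - 1) * thetaSeven) : ℂ) *
          ((bernoulli (2 * j) : ℂ) * (bernoulli (2 * (2 * k + 1 - j)) : ℂ) /
            (((2 * j).factorial : ℂ) * ((2 * (2 * k + 1 - j)).factorial : ℂ))) =
      (1 - 1 / 2 ^ (2 * k) * (Real.cos (4 * k * thetaSeven) : ℂ)) *
        ∑ j ∈ Finset.range (k + 1),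
            (-1 : ℂ) ^ j * (coeffC j k : ℂ) * (bernoulli (2 * j) : ℂ) *
                (bernoulli (4 * k + 2 - 2 * j) : ℂ) /
              (((2 * j).factorial : ℂ) * ((4 * k + 2 - 2 * j).factorial : ℂ)) := by
  rw [sum_range_two_mul_eq_sum_add_reflect, Finset.mul_sum, Finset.mul_sum]
  refine Finset.sum_congr rfl fun j hj => ?_
  have hjk := Finset.mem_range.mp hj
  have hc : (coeffC j k : ℂ) * (1 - 1 / 2 ^ (2 * k) * (Real.cos (4 * k * thetaSeven) : ℂ)) =
      √2 * (1 / 2 ^ j * (Real.cos ((2 * j - 1) * thetaSeven) : ℂ)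
        - 2 ^ j / 2 ^ (2 * k + 1) * (Real.cos ((4 * k + 1 - 2 * j) * thetaSeven) : ℂ)) := by
    simpa only [Complex.ofReal_mul, Complex.ofReal_sub,
      Complex.ofReal_add, Complex.ofReal_neg, Complex.ofReal_div, Complex.ofReal_pow,
      Complex.ofReal_zpow, Complex.ofReal_one, Complex.ofReal_ofNat] using
      congrArg ((↑) : ℝ → ℂ) (coeffC_mul hk j)
  have hcos : (2 * ((2 * k + 1 - j : ℕ) : ℝ) - 1) * thetaSeven =
      (4 * k + 1 - 2 * j) * thetaSeven := by
    rw [Nat.cast_sub (by lia)]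
    push_cast
    ring
  -- The indices j and 2k+1-j have opposite parity, whence the minus sign in c_{jk}.
  have hsign : (-1 : ℂ) ^ (2 * k + 1 - j) / 2 ^ (2 * k + 1 - j) =
      -(-1) ^ j * (2 ^ j / 2 ^ (2 * k + 1)) := by
    obtain ⟨d, hd⟩ := Nat.exists_eq_add_of_le (show j ≤ 2 * k + 1 by lia)
    have h1 : (-1 : ℂ) ^ j * (-1) ^ d = -1 := by
      rw [← pow_add, ← hd, Odd.neg_one_pow ⟨k, rfl⟩]
    have h2 : (-1 : ℂ) ^ j * (-1) ^ j = 1 := by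
      rw [← pow_add, Even.neg_one_pow ⟨j, rfl⟩]
    rw [hd, Nat.add_sub_cancel_left, pow_add]
    field_simp
    linear_combination (-1 : ℂ) ^ j * h1 - (-1 : ℂ) ^ d * h2
  rw [hcos, hsign, show 2 * k + 1 - (2 * k + 1 - j) = j by lia,
    show 2 * (2 * k + 1 - j) = 4 * k + 2 - 2 * j by lia]
  linear_combination (-(-1) ^ j * (bernoulli (2 * j) : ℂ) * (bernoulli (4 * k + 2 - 2 * j) : ℂ) /
    (((2 * j).factorial : ℂ) * ((4 * k + 2 - 2 * j).factorial : ℂ))) * hc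

theorem mainTheorem7 (k : ℕ) (hk : 1 ≤ k) :
    Summable (lambertTerm (Real.exp (-(Real.sqrt 7 * Real.pi)) : ℝ) (-4 * k - 1)) ∧
    Summable (lambertTerm (Real.exp (-(2 * Real.sqrt 7 * Real.pi)) : ℝ) (-4 * k - 1)) ∧
    Summable (lambertTerm (Real.exp (-(4 * Real.sqrt 7 * Real.pi)) : ℝ) (-4 * k - 1)) ∧
    riemannZeta (4 * k + 1) =
      (2 * (Real.pi : ℂ)) ^ (4 * k + 1) *
          ∑ j ∈ Finset.range (k + 1),
            (-1 : ℂ) ^ j * (coeffC j k : ℂ) * (bernoulli (2 * j) : ℂ) *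
                (bernoulli (4 * k + 2 - 2 * j) : ℂ) /
              (((2 * j).factorial : ℂ) * ((4 * k + 2 - 2 * j).factorial : ℂ))
        + (coeffA k : ℂ) * lambertL (Real.exp (-(Real.sqrt 7 * Real.pi)) : ℝ) (-4 * k - 1)
        + (coeffB k : ℂ) * lambertL (Real.exp (-(2 * Real.sqrt 7 * Real.pi)) : ℝ) (-4 * k - 1)
        + (2 : ℂ) ^ (-4 * k : ℤ) * (coeffA k : ℂ) *
            lambertL (Real.exp (-(4 * Real.sqrt 7 * Real.pi)) : ℝ) (-4 * k - 1) := by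
  have hs : (-4 * k - 1 : ℂ) = -((4 * k + 1 : ℕ) : ℂ) := by push_cast; ring
  have hz : (4 * k + 1 : ℂ) = ((4 * k + 1 : ℕ) : ℂ) := by push_cast; ring
  have hpos : 0 < √7 * Real.pi := by positivity
  have hnorm {x : ℝ} (hx : 0 < x) : ‖((Real.exp (-x) : ℝ) : ℂ)‖ < 1 := by
    rw [Complex.norm_real, Real.norm_eq_abs, Real.abs_exp, Real.exp_lt_one_iff]
    linarith
  have hnormI : ‖Complex.I * Complex.exp (-(√7 * Real.pi / 2))‖ < 1 := by
    rw [norm_mul, Complex.norm_I, one_mul]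
    exact_mod_cast hnorm (half_pos hpos)
  rw [hs, hz]
  refine ⟨summable_lambertTerm_neg_natCast (hnorm hpos) _,
    summable_lambertTerm_neg_natCast (hnorm (by positivity)) _,
    summable_lambertTerm_neg_natCast (hnorm (by positivity)) _, ?_⟩
  have hq2 : ((Real.exp (-(2 * √7 * Real.pi)) : ℝ) : ℂ) =
      ((Real.exp (-(√7 * Real.pi)) : ℝ) : ℂ) ^ 2 := by
    rw [← Complex.ofReal_pow, ← Real.exp_nat_mul]; push_cast; ring_nf
  have hq4 : ((Real.exp (-(4 * √7 * Real.pi)) : ℝ) : ℂ) =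
      ((Real.exp (-(√7 * Real.pi)) : ℝ) : ℂ) ^ 4 := by
    rw [← Complex.ofReal_pow, ← Real.exp_nat_mul]; push_cast; ring_nf
  have hr2 : (Complex.I * Complex.exp (-(√7 * Real.pi / 2))) ^ 2 =
      -((Real.exp (-(√7 * Real.pi)) : ℝ) : ℂ) := by
    rw [mul_pow, Complex.I_sq, ← Complex.exp_nat_mul]; push_cast; ring_nf
  have hr4 : (Complex.I * Complex.exp (-(√7 * Real.pi / 2))) ^ 4 =
      ((Real.exp (-(√7 * Real.pi)) : ℝ) : ℂ) ^ 2 := by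
    rw [show 4 = 2 * 2 by norm_num, pow_mul, hr2, neg_sq]
  have key := completedLambert_I_mul_add_neg hk
  have hI := completedLambert_add_neg hnormI (4 * k + 1)
  -- This second use of the Hecke relation, at q, eliminates the value at -q.
  have hq := completedLambert_add_neg (hnorm hpos) (4 * k + 1)
  rw [show Complex.exp (-(√7 * Real.pi)) = ((Real.exp (-(√7 * Real.pi)) : ℝ) : ℂ) by push_cast; rfl,
    hI, hr2, hr4, mul_assoc (_ ^ (4 * k + 1)), bernoulli_sum_eq_coeffC_sum hk] at key
  have hN : (1 - 1 / 2 ^ (2 * k) * (Real.cos (4 * k * thetaSeven) : ℂ)) ≠ 0 := by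
    have h := Complex.ofReal_ne_zero.mpr (one_sub_cos_div_pos hk (4 * k * thetaSeven)).ne'
    simpa only [Complex.ofReal_mul, Complex.ofReal_sub,
      Complex.ofReal_add, Complex.ofReal_neg, Complex.ofReal_div, Complex.ofReal_pow,
      Complex.ofReal_zpow, Complex.ofReal_one, Complex.ofReal_ofNat] using h
  have hA : (coeffA k : ℂ) * (1 - 1 / 2 ^ (2 * k) * (Real.cos (4 * k * thetaSeven) : ℂ)) =
      2 + (1 / 2 ^ (2 * k)) ^ 2 -
        2 * (1 / 2 ^ (2 * k)) * (Real.cos (4 * k * thetaSeven) : ℂ) := by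
    simpa only [Complex.ofReal_mul, Complex.ofReal_sub,
      Complex.ofReal_add, Complex.ofReal_neg, Complex.ofReal_div, Complex.ofReal_pow,
      Complex.ofReal_zpow, Complex.ofReal_one, Complex.ofReal_ofNat] using
      congrArg ((↑) : ℝ → ℂ) (coeffA_mul hk)
  have hB : (coeffB k : ℂ) * (1 - 1 / 2 ^ (2 * k) * (Real.cos (4 * k * thetaSeven) : ℂ)) =
      -(4 + 3 * (1 / 2 ^ (2 * k)) ^ 2 + (1 / 2 ^ (2 * k)) ^ 4
        - 4 * (1 / 2 ^ (2 * k)) * (Real.cos (4 * k * thetaSeven) : ℂ)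
        - 2 * (1 / 2 ^ (2 * k)) ^ 3 * (Real.cos (4 * k * thetaSeven) : ℂ)) := by
    simpa only [Complex.ofReal_mul, Complex.ofReal_sub,
      Complex.ofReal_add, Complex.ofReal_neg, Complex.ofReal_div, Complex.ofReal_pow,
      Complex.ofReal_zpow, Complex.ofReal_one, Complex.ofReal_ofNat] using
      congrArg ((↑) : ℝ → ℂ) (coeffB_mul hk)
  have he : (2 : ℂ) ^ (-4 * k : ℤ) = (1 / 2 ^ (2 * k)) ^ 2 := by
    simpa only [Complex.ofReal_mul, Complex.ofReal_sub,
      Complex.ofReal_add, Complex.ofReal_neg, Complex.ofReal_div, Complex.ofReal_pow,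
      Complex.ofReal_zpow, Complex.ofReal_one, Complex.ofReal_ofNat] using
      congrArg ((↑) : ℝ → ℂ) (two_zpow_eq_pow (k := k) (a := 2) (x := -4 * k) (by push_cast; ring))
  have he' : (2 : ℂ) / 2 ^ (4 * k + 1) = (1 / 2 ^ (2 * k)) ^ 2 := by
    rw [div_pow, ← pow_mul, show 2 * k * 2 = 4 * k by ring, pow_succ]
    field_simp
  rw [he'] at key hq
  rw [show (2 : ℂ) / 2 ^ (2 * k) = 2 * (1 / 2 ^ (2 * k)) by ring] at key
  rw [hq2, hq4, he]
  refine mul_left_cancel₀ hN ?_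
  unfold completedLambert at key hq
  generalize (1 : ℂ) / 2 ^ (2 * k) = e at *
  generalize (Real.cos (4 * k * thetaSeven) : ℂ) = C at *
  -- Here e = 2^{-2k}. The value at -q enters `key` with coefficient 2 + e² - 2eC, the numerator of
  -- a_k. After its elimination, ζ(N)/2 has coefficient (2 + e² - 2eC) - e² = 2(1 - eC).
  linear_combination key - (2 + e ^ 2 - 2 * e * C) * hq -
    (lambertL ((Real.exp (-(√7 * Real.pi)) : ℝ) : ℂ) (-((4 * k + 1 : ℕ) : ℂ)) +
      e ^ 2 * lambertL (((Real.exp (-(√7 * Real.pi)) : ℝ) : ℂ) ^ 4) (-((4 * k + 1 : ℕ) : ℂ))) * hA -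
    lambertL (((Real.exp (-(√7 * Real.pi)) : ℝ) : ℂ) ^ 2) (-((4 * k + 1 : ℕ) : ℂ)) * hB
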